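/- Let $n,k\ge 0$ be integers and let $\mu:\binom{[n]}{k}\to\mathbb{R}_{\ge 0}$ be a probability distribution on the $k$-element subsets of $[n]=\{1,\dots,n\}$, i.e. $\sum_S\mu(S)=1$. Suppose that its generating polynomial \[ g_\mu(z_1,\dots,z_n)=\sum_{S\in\binom{[n]}{k}}\mu(S)\prod_{i\in S}z_i \] is log-concave on $\mathbb{R}_{\ge 0}^n$, that is, $g_\mu(\lambda x+(1-\lambda)y)\ge g_\mu(x)^{\lambda}g_\mu(y)^{1-\lambda}$ for all $x,y\in\mathbb{R}_{\ge 0}^n$ and $\lambda\in(0,1)$. Then for every set $T\subseteq[n]$ of size $l\le k$, \[ \Pr_{S\sim\mu}[T\subseteq S]\;\le\;\alpha(k,l)\cdot\prod_{i\in T}\Pr_{S\sim\mu}[i\in S],\qquad \alpha(k,l)=\binom{k}{l}\left(\frac{l}{k}\right)^{l}, \] where $\alpha(k,0)=1$ by convention. Moreover, for all integers $0\le l\le k$ we have $\alpha(k,l)\le l^l/l!$ (with $0^0=1$) and $\alpha(k,l)\le e^l$, and in particular $\alpha(k,2)\le 2$ for all $k\ge 2$. -/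

import Mathlib

namespace SetDist

open MvPolynomial

/-- The family of all `k`-element subsets of an `n`-element ground set. -/
abbrev KSubset (n k : ℕ) : Type := {S : Finset (Fin n) // S.card = k}

/-- The generating polynomial `∑_S μ(S) ∏_{i ∈ S} z_i`. -/
noncomputable def genPoly {n k : ℕ} (μ : KSubset n k → ℝ) : MvPolynomial (Fin n) ℝ :=
  ∑ S : KSubset n k, C (μ S) * ∏ i ∈ S.1, X i

/-- A polynomial with nonnegative coefficients is log-concave if it is log-concave as a function
on the closed nonnegative orthant. -/
def IsLogConcave {n : ℕ} (g : MvPolynomial (Fin n) ℝ) : Prop :=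
  (∀ m, 0 ≤ g.coeff m) ∧
    ∀ x y : Fin n → ℝ, 0 ≤ x → 0 ≤ y → ∀ t : ℝ, 0 < t → t < 1 →
      eval x g ^ t * eval y g ^ (1 - t) ≤ eval (t • x + (1 - t) • y) g

/-- The probability of the event `E` when a `k`-element set is drawn from `μ`. -/
def prob {n k : ℕ} (μ : KSubset n k → ℝ) (E : Finset (Fin n) → Prop) [DecidablePred E] : ℝ :=
  ∑ S : KSubset n k with E S.1, μ S

/-- `α(k, l) = (k choose l) (l / k) ^ l`; for `l = 0` the value is `1`, also when `k = 0`. -/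
noncomputable def alpha (k l : ℕ) : ℝ := (k.choose l : ℝ) * ((l : ℝ) / (k : ℝ)) ^ l

end SetDist

/-!
Let `D_v` be the derivative in the direction `v`. A log-concave polynomial `p` that is affine in a
direction `u ≥ 0` has a log-concave derivative `D_u p`, the limit of `ε * p (x + ε⁻¹ u)`.
Hence, if `p` is affine in each of the directions `u i`, `i ∈ T`, all mixed derivatives of `p` in
these directions are log-concave, and so their Hessians at a positive point have at most one
positive eigenvalue.

This signature passes to the Hessian of `D_v^j p`, where `v = ∑ i ∈ T, u i`. Indeed, if the Hessians
of `D_a p` and `D_b p` have this signature, then so does their sum, because both are negative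
semidefinite on the hyperplane of directions `c` with `D_a D_b D_c p = 0`.
The reversed Cauchy–Schwarz inequality and Euler's identity then turn the signature into Newton's
inequalities for the sequence `D_v^j p (x)`, which bound `D_v^l p (x)` in terms of `p (x)` and
`D_v p (x)`. For `l = #T`, `D_v^l p` is `l!` times the mixed derivative in all directions of `T`.
Optimising over the lengths of the `u i` turns the power of the mean of the numbers `D_{u i} p (x)`
in this bound into their product.

For the generating polynomial, `x = 1` and the coordinate directions, these derivatives are the
probabilities of `T ⊆ S` and of `i ∈ S`.
-/

namespace SetDist

open Finset MvPolynomial Filter Topology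

section BilinForm

variable {V : Type*} [AddCommGroup V] [Module ℝ V] {B B' : LinearMap.BilinForm ℝ V}

/-- Hyperbolicity of a bilinear form, encoded as the reversed Cauchy–Schwarz inequality so that it
can be applied directly. For a symmetric form it says that there is at most one positive
eigenvalue; symmetry itself is not part of the definition. -/
def IsHyperbolic (B : LinearMap.BilinForm ℝ V) : Prop :=
  ∀ a b, 0 < B a a → B a a * B b b ≤ B a b ^ 2

theorem isHyperbolic_zero : IsHyperbolic (0 : LinearMap.BilinForm ℝ V) := fun _ _ _ => by simp

theorem isHyperbolic_of_nonpos_of_mem_ker (hB : B.IsSymm) (ξ : V →ₗ[ℝ] ℝ)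
    (h : ∀ b, ξ b = 0 → B b b ≤ 0) : IsHyperbolic B := by
  intro a b ha
  have hξ : ξ a ≠ 0 := fun h0 => (h a h0).not_gt ha
  have hproj := h (b - (ξ b / ξ a) • a) (by simp [hξ])
  generalize ξ b / ξ a = c at hproj
  simp only [map_sub, map_smul, LinearMap.sub_apply, LinearMap.smul_apply, smul_eq_mul,
    hB.eq b a] at hproj
  nlinarith [sq_nonneg (B a b - c * B a a)]

theorem IsHyperbolic.nonpos_of_orthogonal (h : IsHyperbolic B) (hB : B.IsSymm) {u b : V}
    (hu : 0 ≤ B u u) (hu0 : B u ≠ 0) (hub : B u b = 0) : B b b ≤ 0 := by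
  by_contra! hb
  obtain ⟨x, hux⟩ : ∃ x, B u x ≠ 0 := by simpa using DFunLike.ne_iff.1 hu0
  set y := x - (B b x / B b b) • b
  have hby : B b y = 0 := by simp [y, hb.ne']
  have huy : B u y = B u x := by simp [y, hub]
  -- `K` is chosen so that `y + K • u`, which is orthogonal to `b`, has positive norm.
  set K := (1 - B y y) / (2 * B u x)
  have hK : 2 * K * B u x = 1 - B y y := by simp only [K]; field_simp
  have hbz : B b (y + K • u) = 0 := by simp [hby, hB.eq b u, hub]
  have hzz : B (y + K • u) (y + K • u) = 1 + K ^ 2 * B u u := by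
    simp only [map_add, map_smul, LinearMap.add_apply, LinearMap.smul_apply, smul_eq_mul,
      hB.eq y u, huy]
    linarith
  have hrev := h b (y + K • u) hb
  rw [hbz, hzz] at hrev
  nlinarith [mul_nonneg (sq_nonneg K) hu]

/-- Both forms are negative semidefinite on the hyperplane `B u = 0`. -/
theorem IsHyperbolic.add (h : IsHyperbolic B) (h' : IsHyperbolic B') (hB : B.IsSymm)
    (hB' : B'.IsSymm) {u w : V} (hu : 0 ≤ B u u) (hw : 0 ≤ B' w w) (huw : B u = B' w)
    (hu0 : B u ≠ 0) : IsHyperbolic (B + B') :=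
  isHyperbolic_of_nonpos_of_mem_ker (hB.add hB') (B u) fun _ hb =>
    add_nonpos (h.nonpos_of_orthogonal hB hu hu0 hb)
      (h'.nonpos_of_orthogonal hB' hw (huw ▸ hu0) (huw ▸ hb))

end BilinForm

section DirDeriv

variable {R σ ι : Type*} [CommRing R]

theorem pderiv_pderiv_comm (i j : σ) (p : MvPolynomial σ R) :
    pderiv i (pderiv j p) = pderiv j (pderiv i p) := by
  rcases eq_or_ne i j with rfl | hij
  · rfl
  · ext m
    simp only [coeff_pderiv, Finsupp.add_apply, Finsupp.single_eq_of_ne hij,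
      Finsupp.single_eq_of_ne hij.symm, add_zero, add_right_comm m (Finsupp.single i 1)]
    ring

variable [Fintype σ]

/-- The directional derivative `∑ i, v i ∂ᵢ` of polynomials, as a linear function of the
direction `v`. -/
noncomputable def dirDeriv : (σ → R) →ₗ[R] Module.End R (MvPolynomial σ R) :=
  Fintype.linearCombination R fun i => (pderiv i).toLinearMap

theorem dirDeriv_apply (v : σ → R) (p : MvPolynomial σ R) :
    dirDeriv v p = ∑ i, v i • pderiv i p := by
  simp [dirDeriv, Fintype.linearCombination_apply, LinearMap.sum_apply]

theorem dirDeriv_single [DecidableEq σ] (i : σ) (c : R) (p : MvPolynomial σ R) :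
    dirDeriv (Pi.single i c) p = c • pderiv i p := by
  simp [dirDeriv, Fintype.linearCombination_apply_single]

theorem dirDeriv_commute (a b : σ → R) : Commute (dirDeriv a) (dirDeriv b) := by
  refine LinearMap.ext fun p => ?_
  simp only [Module.End.mul_apply, dirDeriv_apply, map_sum, Derivation.map_smul]
  rw [sum_comm]
  exact sum_congr rfl fun i _ => sum_congr rfl fun j _ => by
    rw [pderiv_pderiv_comm, smul_comm]

theorem dirDeriv_dirDeriv_comm (a b : σ → R) (p : MvPolynomial σ R) :
    dirDeriv a (dirDeriv b p) = dirDeriv b (dirDeriv a p) :=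
  LinearMap.congr_fun (dirDeriv_commute a b) p

theorem dirDeriv_pow_dirDeriv_comm (a b : σ → R) (j : ℕ) (p : MvPolynomial σ R) :
    dirDeriv a ((dirDeriv b ^ j) p) = (dirDeriv b ^ j) (dirDeriv a p) :=
  LinearMap.congr_fun ((dirDeriv_commute a b).pow_right j) p

theorem isHomogeneous_dirDeriv {p : MvPolynomial σ R} {d : ℕ} (hp : p.IsHomogeneous d)
    (v : σ → R) : (dirDeriv v p).IsHomogeneous (d - 1) := by
  rw [dirDeriv_apply]
  exact Submodule.sum_mem (homogeneousSubmodule σ R (d - 1)) fun i _ =>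
    Submodule.smul_mem _ _ hp.pderiv

theorem isHomogeneous_pow_dirDeriv {p : MvPolynomial σ R} {d : ℕ} (hp : p.IsHomogeneous d)
    (v : σ → R) (j : ℕ) : ((dirDeriv v ^ j) p).IsHomogeneous (d - j) := by
  induction j with
  | zero => exact hp
  | succ j ih =>
    rw [pow_succ', Module.End.mul_apply, ← Nat.sub_sub]
    exact isHomogeneous_dirDeriv ih v

theorem eval_dirDeriv_self {p : MvPolynomial σ R} {d : ℕ} (hp : p.IsHomogeneous d) (x : σ → R) :
    eval x (dirDeriv x p) = d * eval x p := by
  simpa [dirDeriv_apply, smul_eval] using congrArg (eval x) hp.sum_X_mul_pderiv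

/-- The mixed derivative `∏ i ∈ B, D (u i)`, where `D (u i)` is the derivative in the
direction `u i`. -/
noncomputable def mixedDeriv (u : ι → σ → R) (B : Finset ι) : Module.End R (MvPolynomial σ R) :=
  B.noncommProd (fun i => dirDeriv (u i)) fun i _ j _ _ => dirDeriv_commute (u i) (u j)

variable {u : ι → σ → R}

theorem mixedDeriv_empty (p : MvPolynomial σ R) : mixedDeriv u ∅ p = p :=
  LinearMap.congr_fun (noncommProd_empty _ _) p

theorem mixedDeriv_singleton (i : ι) (p : MvPolynomial σ R) :
    mixedDeriv u {i} p = dirDeriv (u i) p :=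
  LinearMap.congr_fun (noncommProd_singleton _ _) p

theorem dirDeriv_mixedDeriv_comm (a : σ → R) (B : Finset ι) (p : MvPolynomial σ R) :
    dirDeriv a (mixedDeriv u B p) = mixedDeriv u B (dirDeriv a p) :=
  LinearMap.congr_fun
    (noncommProd_commute B _ _ (dirDeriv a) fun i _ => dirDeriv_commute a (u i)) p

theorem mixedDeriv_insert [DecidableEq ι] {B : Finset ι} {i : ι} (hi : i ∉ B)
    (p : MvPolynomial σ R) :
    mixedDeriv u (insert i B) p = dirDeriv (u i) (mixedDeriv u B p) :=
  LinearMap.congr_fun (noncommProd_insert_of_notMem _ _ _ _ hi) p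

theorem mixedDeriv_eq_mixedDeriv_erase [DecidableEq ι] {B : Finset ι} {i : ι} (hi : i ∈ B)
    (p : MvPolynomial σ R) : mixedDeriv u B p = mixedDeriv u (B.erase i) (dirDeriv (u i) p) := by
  rw [← dirDeriv_mixedDeriv_comm, ← mixedDeriv_insert (notMem_erase i B), insert_erase hi]

theorem mixedDeriv_smul (c : ι → R) (B : Finset ι) (p : MvPolynomial σ R) :
    mixedDeriv (fun i => c i • u i) B p = (∏ i ∈ B, c i) • mixedDeriv u B p := by
  classical
  induction B using Finset.induction_on with
  | empty => simp [mixedDeriv_empty]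
  | insert i B hi ih =>
    simp only [mixedDeriv_insert hi, ih, prod_insert hi, map_smul, LinearMap.smul_apply, mul_smul]
    exact smul_comm _ _ _

theorem isHomogeneous_mixedDeriv {p : MvPolynomial σ R} {d : ℕ} (hp : p.IsHomogeneous d)
    (B : Finset ι) : (mixedDeriv u B p).IsHomogeneous (d - #B) := by
  classical
  induction B using Finset.induction_on with
  | empty => simpa [mixedDeriv_empty] using hp
  | insert i B hi ih =>
    rw [mixedDeriv_insert hi, card_insert_of_notMem hi, ← Nat.sub_sub]
    exact isHomogeneous_dirDeriv ih (u i)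

variable {T B : Finset ι} {p : MvPolynomial σ R}

theorem dirDeriv_sum_mixedDeriv [DecidableEq ι]
    (hsq : ∀ i ∈ T, dirDeriv (u i) (dirDeriv (u i) p) = 0) (hB : B ⊆ T) :
    dirDeriv (∑ i ∈ T, u i) (mixedDeriv u B p) =
      dirDeriv (∑ i ∈ T \ B, u i) (mixedDeriv u B p) := by
  have hzero : ∀ i ∈ B, dirDeriv (u i) (mixedDeriv u B p) = 0 := fun i hi => by
    rw [dirDeriv_mixedDeriv_comm, mixedDeriv_eq_mixedDeriv_erase hi, hsq i (hB hi), map_zero]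
  rw [← sum_sdiff hB, map_add, LinearMap.add_apply, map_sum, map_sum, LinearMap.sum_apply,
    LinearMap.sum_apply, sum_eq_zero hzero, add_zero]

theorem pow_dirDeriv_sum_mixedDeriv (hsq : ∀ i ∈ T, dirDeriv (u i) (dirDeriv (u i) p) = 0)
    (hB : B ⊆ T) {j : ℕ} (hj : #B + j = #T) :
    (dirDeriv (∑ i ∈ T, u i) ^ j) (mixedDeriv u B p) = j.factorial • mixedDeriv u T p := by
  classical
  induction j generalizing B with
  | zero => simp [eq_of_subset_of_card_le hB hj.ge]
  | succ j ih =>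
    have hterm : ∀ i ∈ T \ B, (dirDeriv (∑ i ∈ T, u i) ^ j) (mixedDeriv u (insert i B) p) =
        j.factorial • mixedDeriv u T p := by
      intro i hi
      obtain ⟨hiT, hiB⟩ := mem_sdiff.1 hi
      refine ih (insert_subset hiT hB) ?_
      rw [card_insert_of_notMem hiB]
      omega
    have hdir : dirDeriv (∑ i ∈ T, u i) (mixedDeriv u B p) =
        ∑ i ∈ T \ B, mixedDeriv u (insert i B) p := by
      rw [dirDeriv_sum_mixedDeriv hsq hB, map_sum, LinearMap.sum_apply]
      exact sum_congr rfl fun i hi => (mixedDeriv_insert (mem_sdiff.1 hi).2 p).symm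
    have hcard : #(T \ B) = j + 1 := by rw [card_sdiff_of_subset hB]; omega
    rw [pow_succ, Module.End.mul_apply, hdir, map_sum, sum_congr rfl hterm, sum_const, hcard,
      smul_smul, Nat.factorial_succ]

theorem pow_dirDeriv_sum_mixedDeriv_ne_zero [IsAddTorsionFree R]
    (hsq : ∀ i ∈ T, dirDeriv (u i) (dirDeriv (u i) p) = 0) (hne : mixedDeriv u T p ≠ 0)
    (hB : B ⊆ T) {j : ℕ} (hj : #B + j ≤ #T) :
    (dirDeriv (∑ i ∈ T, u i) ^ j) (mixedDeriv u B p) ≠ 0 := by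
  intro h0
  have htop := pow_dirDeriv_sum_mixedDeriv hsq hB (j := #T - #B - j + j) (by omega)
  rw [pow_add, Module.End.mul_apply, h0, map_zero] at htop
  exact smul_ne_zero (Nat.factorial_ne_zero _) hne htop.symm

end DirDeriv

section Nonneg

variable {R σ : Type*} [CommRing R] [PartialOrder R] {p : MvPolynomial σ R}

theorem eval_nonneg_of_coeff_nonneg [IsOrderedRing R] (hp : ∀ m, 0 ≤ p.coeff m) {x : σ → R}
    (hx : 0 ≤ x) : 0 ≤ eval x p := by
  rw [eval_eq]
  exact sum_nonneg fun m _ => mul_nonneg (hp m) (prod_nonneg fun i _ => pow_nonneg (hx i) _)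

theorem eval_pos_of_coeff_nonneg [IsStrictOrderedRing R] (hp : ∀ m, 0 ≤ p.coeff m) (hp0 : p ≠ 0)
    {x : σ → R} (hx : ∀ i, 0 < x i) : 0 < eval x p := by
  rw [eval_eq]
  obtain ⟨m, hm⟩ := support_nonempty.2 hp0
  have hmono (m : σ →₀ ℕ) : 0 < ∏ i ∈ m.support, x i ^ m i := prod_pos fun i _ => pow_pos (hx i) _
  exact sum_pos' (fun m _ => mul_nonneg (hp m) (hmono m).le)
    ⟨m, hm, mul_pos ((hp m).lt_of_ne' (mem_support_iff.1 hm)) (hmono m)⟩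

theorem coeff_dirDeriv_nonneg [IsOrderedRing R] [Fintype σ] (hp : ∀ m, 0 ≤ p.coeff m) {v : σ → R}
    (hv : 0 ≤ v) (m : σ →₀ ℕ) : 0 ≤ (dirDeriv v p).coeff m := by
  rw [dirDeriv_apply, coeff_sum]
  refine sum_nonneg fun i _ => ?_
  rw [coeff_smul, coeff_pderiv, smul_eq_mul]
  exact mul_nonneg (hv i) (mul_nonneg (hp _) (add_nonneg (Nat.cast_nonneg _) zero_le_one))

theorem coeff_pow_dirDeriv_nonneg [IsOrderedRing R] [Fintype σ] (hp : ∀ m, 0 ≤ p.coeff m)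
    {v : σ → R} (hv : 0 ≤ v) (j : ℕ) : ∀ m, 0 ≤ ((dirDeriv v ^ j) p).coeff m := by
  induction j with
  | zero => exact hp
  | succ j ih => simpa [pow_succ'] using coeff_dirDeriv_nonneg ih hv

end Nonneg

section Calculus

variable {σ : Type*} [Fintype σ]

theorem hasDerivAt_eval_add_smul (p : MvPolynomial σ ℝ) (x v : σ → ℝ) (t : ℝ) :
    HasDerivAt (fun s => eval (x + s • v) p) (eval (x + t • v) (dirDeriv v p)) t := by
  induction p using MvPolynomial.induction_on with
  | C a => simpa [dirDeriv_apply] using hasDerivAt_const t a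
  | add p q hp hq => simpa using hp.fun_add hq
  | mul_X p i hp =>
    classical
    have hX : HasDerivAt (fun s => eval (x + s • v) (X i : MvPolynomial σ ℝ)) (v i) t := by
      simpa using ((hasDerivAt_id t).mul_const (v i)).const_add (x i)
    have hmul : dirDeriv v (p * X i) = dirDeriv v p * X i + p * C (v i) := by
      simp only [dirDeriv_apply, pderiv_mul, pderiv_X, Pi.single_apply, smul_add, sum_add_distrib,
        sum_mul, smul_mul_assoc]
      simp [mul_comm, smul_eq_C_mul]
    simpa [hmul] using hp.fun_mul hX

variable {p : MvPolynomial σ ℝ} {v : σ → ℝ}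

theorem eval_add_smul_of_dirDeriv_eq_zero (h : dirDeriv v p = 0) (x : σ → ℝ) (t : ℝ) :
    eval (x + t • v) p = eval x p := by
  have hderiv (s : ℝ) : HasDerivAt (fun s => eval (x + s • v) p) 0 s := by
    simpa [h] using hasDerivAt_eval_add_smul p x v s
  simpa using is_const_of_deriv_eq_zero (fun s => (hderiv s).differentiableAt)
    (fun s => (hderiv s).deriv) t 0

theorem eval_add_smul_of_dirDeriv_dirDeriv_eq_zero (h : dirDeriv v (dirDeriv v p) = 0)
    (x : σ → ℝ) (t : ℝ) : eval (x + t • v) p = eval x p + t * eval x (dirDeriv v p) := by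
  have hderiv (s : ℝ) : HasDerivAt
      (fun s => eval (x + s • v) p - s * eval x (dirDeriv v p)) 0 s := by
    simpa [eval_add_smul_of_dirDeriv_eq_zero h] using
      (hasDerivAt_eval_add_smul p x v s).fun_sub
        ((hasDerivAt_id s).mul_const (eval x (dirDeriv v p)))
  have hconst := is_const_of_deriv_eq_zero (fun s => (hderiv s).differentiableAt)
    (fun s => (hderiv s).deriv) t 0
  simpa [sub_eq_iff_eq_add] using hconst

end Calculus

section Hessian

variable {R σ : Type*} [CommRing R] [Fintype σ]

/-- The second derivative of `p` at `x`, as a bilinear form in the two directions. -/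
noncomputable def hessian (p : MvPolynomial σ R) (x : σ → R) : LinearMap.BilinForm R (σ → R) :=
  LinearMap.mk₂ R (fun a b => eval x (dirDeriv a (dirDeriv b p)))
    (by simp) (by simp [smul_eval]) (by simp) (by simp [smul_eval])

theorem hessian_apply (p : MvPolynomial σ R) (x a b : σ → R) :
    hessian p x a b = eval x (dirDeriv a (dirDeriv b p)) := rfl

theorem isSymm_hessian (p : MvPolynomial σ R) (x : σ → R) : (hessian p x).IsSymm :=
  ⟨fun a b => congrArg (eval x) (dirDeriv_dirDeriv_comm a b p)⟩

theorem hessian_add (p q : MvPolynomial σ R) (x : σ → R) :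
    hessian (p + q) x = hessian p x + hessian q x := by
  ext; simp [hessian_apply]

theorem hessian_dirDeriv_comm (p : MvPolynomial σ R) (x a b : σ → R) :
    hessian (dirDeriv a p) x b = hessian (dirDeriv b p) x a := by
  refine LinearMap.ext fun c => ?_
  simp only [hessian_apply]
  rw [dirDeriv_dirDeriv_comm c a, dirDeriv_dirDeriv_comm b a, dirDeriv_dirDeriv_comm c b]

end Hessian

section HyperbolicHessian

variable {σ : Type*} [Fintype σ] {p : MvPolynomial σ ℝ} {x : σ → ℝ} {d : ℕ}

theorem isHyperbolic_hessian_dirDeriv_add (hp : p.IsHomogeneous d) (hd : 3 ≤ d)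
    (hcoeff : ∀ m, 0 ≤ p.coeff m) (hx : 0 ≤ x) {u w : σ → ℝ} (hu : 0 ≤ u) (hw : 0 ≤ w)
    (huw : 0 < eval x (dirDeriv u (dirDeriv w p))) (hhu : IsHyperbolic (hessian (dirDeriv u p) x))
    (hhw : IsHyperbolic (hessian (dirDeriv w p) x)) :
    IsHyperbolic (hessian (dirDeriv (u + w) p) x) := by
  have hnonneg {a b : σ → ℝ} (ha : 0 ≤ a) (hb : 0 ≤ b) : 0 ≤ hessian (dirDeriv a p) x b b :=
    eval_nonneg_of_coeff_nonneg
      (coeff_dirDeriv_nonneg (coeff_dirDeriv_nonneg (coeff_dirDeriv_nonneg hcoeff ha) hb) hb) hx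
  have hne : hessian (dirDeriv u p) x w ≠ 0 := fun h0 => by
    -- By Euler's identity the linear form is positive at `x`.
    have heuler : hessian (dirDeriv u p) x w x =
        (d - 1 - 1 : ℕ) * eval x (dirDeriv u (dirDeriv w p)) := by
      rw [(isSymm_hessian _ _).eq, hessian_apply, dirDeriv_dirDeriv_comm w u,
        eval_dirDeriv_self (isHomogeneous_dirDeriv (isHomogeneous_dirDeriv hp w) u)]
    rw [h0, LinearMap.zero_apply] at heuler
    have : 0 < d - 1 - 1 := by omega
    exact (by positivity : (0 : ℝ) < (d - 1 - 1 : ℕ) * eval x (dirDeriv u (dirDeriv w p))).ne heuler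
  rw [map_add, LinearMap.add_apply, hessian_add]
  exact hhu.add hhw (isSymm_hessian _ _) (isSymm_hessian _ _) (hnonneg hu hw) (hnonneg hw hu)
    (hessian_dirDeriv_comm p x u w) hne

theorem isHyperbolic_hessian_dirDeriv_sum {ι : Type*} (hp : p.IsHomogeneous d) (hd : 3 ≤ d)
    (hcoeff : ∀ m, 0 ≤ p.coeff m) (hx : 0 ≤ x) {u : ι → σ → ℝ} {A : Finset ι}
    (hu : ∀ i ∈ A, 0 ≤ u i)
    (hpos : ∀ i ∈ A, ∀ j ∈ A, i ≠ j → 0 < eval x (dirDeriv (u i) (dirDeriv (u j) p)))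
    (hhyp : ∀ i ∈ A, IsHyperbolic (hessian (dirDeriv (u i) p) x)) :
    IsHyperbolic (hessian (dirDeriv (∑ i ∈ A, u i) p) x) := by
  classical
  induction A using Finset.induction_on with
  | empty =>
    convert isHyperbolic_zero
    ext; simp [hessian_apply]
  | insert i A hi ih =>
    rcases A.eq_empty_or_nonempty with rfl | hA
    · simpa using hhyp i (mem_insert_self i ∅)
    rw [sum_insert hi]
    refine isHyperbolic_hessian_dirDeriv_add hp hd hcoeff hx (hu i (mem_insert_self i A))
      (sum_nonneg fun j hj => hu j (mem_insert_of_mem hj)) ?_ (hhyp i (mem_insert_self i A))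
      (ih (fun j hj => hu j (mem_insert_of_mem hj))
        (fun j hj l hl => hpos j (mem_insert_of_mem hj) l (mem_insert_of_mem hl))
        fun j hj => hhyp j (mem_insert_of_mem hj))
    simp only [map_sum, LinearMap.sum_apply]
    exact sum_pos (fun j hj => hpos i (mem_insert_self i A) j (mem_insert_of_mem hj)
      (ne_of_mem_of_not_mem hj hi).symm) hA

theorem newton_inequality_of_isHyperbolic_hessian (hp : p.IsHomogeneous (d + 1)) (hd : 0 < d)
    (hpx : 0 < eval x p) (hhyp : IsHyperbolic (hessian p x)) (v : σ → ℝ) :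
    (d + 1) * (eval x p * eval x (dirDeriv v (dirDeriv v p))) ≤ d * eval x (dirDeriv v p) ^ 2 := by
  have hd' : (0 : ℝ) < d := by exact_mod_cast hd
  have hxv (w : σ → ℝ) : hessian p x x w = d * eval x (dirDeriv w p) :=
    eval_dirDeriv_self (isHomogeneous_dirDeriv hp w) x
  have hxx : hessian p x x x = d * ((d + 1) * eval x p) := by
    rw [hxv, eval_dirDeriv_self hp, Nat.cast_add_one]
  have hrev := hhyp x v (by rw [hxx]; positivity)
  rw [hxx, hxv, hessian_apply] at hrev
  refine le_of_mul_le_mul_left ?_ hd'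
  linarith

end HyperbolicHessian

section Newton

variable {b : ℕ → ℝ} {k l : ℕ}

theorem mul_le_of_newton_inequalities (hl : l ≤ k) (hpos : ∀ j ≤ l, 0 < b j)
    (hb : ∀ j, j + 2 ≤ l → (k - j) * (b j * b (j + 2)) ≤ (k - j - 1) * b (j + 1) ^ 2) {j : ℕ}
    (hj : j < l) : k * b 0 * b (j + 1) ≤ (k - j) * (b 1 * b j) := by
  induction j with
  | zero => exact le_of_eq (by push_cast; ring)
  | succ j ih =>
    have hjk : (j : ℝ) + 2 ≤ k := by exact_mod_cast (show j + 2 ≤ k by omega)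
    have hj0 := hpos j (by omega)
    have hj1 := hpos (j + 1) (by omega)
    have h0 := hpos 0 (by omega)
    refine le_of_mul_le_mul_left ?_ (mul_pos (by linarith : (0 : ℝ) < k - j) hj0)
    calc (k - j) * b j * (k * b 0 * b (j + 1 + 1))
        = k * b 0 * ((k - j) * (b j * b (j + 2))) := by ring
      _ ≤ k * b 0 * ((k - j - 1) * b (j + 1) ^ 2) :=
        mul_le_mul_of_nonneg_left (hb j (by omega)) (by positivity)
      _ = (k - j - 1) * b (j + 1) * (k * b 0 * b (j + 1)) := by ring
      _ ≤ (k - j - 1) * b (j + 1) * ((k - j) * (b 1 * b j)) :=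
        mul_le_mul_of_nonneg_left (ih (by omega))
          (mul_nonneg (by linarith) hj1.le)
      _ = (k - j) * b j * ((k - (j + 1 : ℕ)) * (b 1 * b (j + 1))) := by push_cast; ring

theorem pow_mul_le_descFactorial_mul_of_newton_inequalities (hl : l ≤ k)
    (hpos : ∀ j ≤ l, 0 < b j)
    (hb : ∀ j, j + 2 ≤ l → (k - j) * (b j * b (j + 2)) ≤ (k - j - 1) * b (j + 1) ^ 2) :
    (k * b 0) ^ l * b l ≤ k.descFactorial l * b 1 ^ l * b 0 := by
  have h0 := hpos 0 (by omega)
  suffices ∀ j ≤ l, (k * b 0) ^ j * b j ≤ k.descFactorial j * b 1 ^ j * b 0 from this l le_rfl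
  intro j hj
  induction j with
  | zero => simp
  | succ j ih =>
    have hjk : (j : ℝ) + 1 ≤ k := by exact_mod_cast hj.trans hl
    have h1 := hpos 1 (by omega)
    have hkj : (0 : ℝ) ≤ k - j := by linarith
    calc (k * b 0) ^ (j + 1) * b (j + 1) = (k * b 0) ^ j * (k * b 0 * b (j + 1)) := by ring
      _ ≤ (k * b 0) ^ j * ((k - j) * (b 1 * b j)) :=
        mul_le_mul_of_nonneg_left (mul_le_of_newton_inequalities hl hpos hb hj) (by positivity)
      _ = (k - j) * b 1 * ((k * b 0) ^ j * b j) := by ring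
      _ ≤ (k - j) * b 1 * (k.descFactorial j * b 1 ^ j * b 0) :=
        mul_le_mul_of_nonneg_left (ih (by omega)) (by positivity)
      _ = k.descFactorial (j + 1) * b 1 ^ (j + 1) * b 0 := by
        rw [Nat.descFactorial_succ, Nat.cast_mul, Nat.cast_sub (by omega)]; ring

end Newton

section LogConcave

theorem deriv_deriv_nonpos_of_isLocalMax {f : ℝ → ℝ} {a : ℝ} (h : IsLocalMax f a)
    (hf : ContinuousAt f a) : deriv (deriv f) a ≤ 0 := by
  by_contra! hpos
  have hmin := isLocalMin_of_deriv_deriv_pos hpos h.deriv_eq_zero hf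
  have hconst : f =ᶠ[𝓝 a] fun _ => f a := by
    filter_upwards [h, hmin] with x using le_antisymm
  simp [hconst.deriv.deriv_eq] at hpos

variable {n : ℕ} {p : MvPolynomial (Fin n) ℝ} {x : Fin n → ℝ}

theorem isLogConcave_dirDeriv (h : IsLogConcave p) {v : Fin n → ℝ} (hv : 0 ≤ v)
    (hsq : dirDeriv v (dirDeriv v p) = 0) : IsLogConcave (dirDeriv v p) := by
  refine ⟨coeff_dirDeriv_nonneg h.1 hv, fun x y hx hy t ht ht1 => ?_⟩
  -- `p` is affine in the direction `v`, so `D_v p` is the limit of `ε * p (· + ε⁻¹ v)`.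
  have hscale (z : Fin n → ℝ) {ε : ℝ} (hε : 0 < ε) :
      ε * eval (z + ε⁻¹ • v) p = ε * eval z p + eval z (dirDeriv v p) := by
    rw [eval_add_smul_of_dirDeriv_dirDeriv_eq_zero hsq]
    field_simp
  have hlim (z : Fin n → ℝ) : Tendsto (fun ε => ε * eval z p + eval z (dirDeriv v p)) (𝓝[>] 0)
      (𝓝 (eval z (dirDeriv v p))) :=
    (Continuous.tendsto' (by fun_prop) _ _ (by simp)).mono_left nhdsWithin_le_nhds
  refine le_of_tendsto_of_tendsto
    (((hlim x).rpow_const (Or.inr ht.le)).mul ((hlim y).rpow_const (Or.inr (sub_nonneg.2 ht1.le))))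
    (hlim (t • x + (1 - t) • y)) ?_
  filter_upwards [self_mem_nhdsWithin] with ε (hε : 0 < ε)
  have hxε : 0 ≤ x + ε⁻¹ • v := add_nonneg hx (smul_nonneg (inv_nonneg.2 hε.le) hv)
  have hyε : 0 ≤ y + ε⁻¹ • v := add_nonneg hy (smul_nonneg (inv_nonneg.2 hε.le) hv)
  have hmid : t • x + (1 - t) • y + ε⁻¹ • v =
      t • (x + ε⁻¹ • v) + (1 - t) • (y + ε⁻¹ • v) := by module
  rw [← hscale x hε, ← hscale y hε, ← hscale _ hε, hmid,
    Real.mul_rpow hε.le (eval_nonneg_of_coeff_nonneg h.1 hxε),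
    Real.mul_rpow hε.le (eval_nonneg_of_coeff_nonneg h.1 hyε), mul_mul_mul_comm,
    ← Real.rpow_add hε, add_sub_cancel, Real.rpow_one]
  exact mul_le_mul_of_nonneg_left (h.2 _ _ hxε hyε t ht ht1) hε.le

theorem isLogConcave_mixedDeriv {ι : Type*} (h : IsLogConcave p) {u : ι → Fin n → ℝ}
    {B : Finset ι} (hu : ∀ i ∈ B, 0 ≤ u i)
    (hsq : ∀ i ∈ B, dirDeriv (u i) (dirDeriv (u i) p) = 0) : IsLogConcave (mixedDeriv u B p) := by
  classical
  induction B using Finset.induction_on with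
  | empty => rwa [mixedDeriv_empty]
  | insert i B hi ih =>
    rw [mixedDeriv_insert hi]
    refine isLogConcave_dirDeriv (ih (fun j hj => hu j (mem_insert_of_mem hj))
      fun j hj => hsq j (mem_insert_of_mem hj)) (hu i (mem_insert_self i B)) ?_
    rw [dirDeriv_mixedDeriv_comm, dirDeriv_mixedDeriv_comm, hsq i (mem_insert_self i B), map_zero]

theorem IsLogConcave.eval_mul_eval_le_sq (h : IsLogConcave p) {y : Fin n → ℝ} (hadd : 0 ≤ x + y)
    (hsub : 0 ≤ x - y) : eval (x + y) p * eval (x - y) p ≤ eval x p ^ 2 := by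
  have hA := eval_nonneg_of_coeff_nonneg h.1 hadd
  have hB := eval_nonneg_of_coeff_nonneg h.1 hsub
  have hmid := h.2 _ _ hadd hsub (1 / 2) (by norm_num) (by norm_num)
  rw [show (1 / 2 : ℝ) • (x + y) + (1 - 1 / 2 : ℝ) • (x - y) = x by module,
    show (1 - 1 / 2 : ℝ) = 1 / 2 by norm_num, ← Real.mul_rpow hA hB, ← Real.sqrt_eq_rpow] at hmid
  exact Real.sqrt_le_iff.1 hmid |>.2

theorem IsLogConcave.eval_mul_eval_dirDeriv_dirDeriv_le_sq (h : IsLogConcave p)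
    (hx : ∀ i, 0 < x i) (v : Fin n → ℝ) :
    eval x p * eval x (dirDeriv v (dirDeriv v p)) ≤ eval x (dirDeriv v p) ^ 2 := by
  set φ : ℝ → ℝ := fun t => eval (x + t • v) p * eval (x + t • -v) p
  set φ' : ℝ → ℝ := fun t => eval (x + t • v) (dirDeriv v p) * eval (x + t • -v) p +
    eval (x + t • v) p * eval (x + t • -v) (dirDeriv (-v) p)
  have hφ (t : ℝ) : HasDerivAt φ (φ' t) t :=
    (hasDerivAt_eval_add_smul p x v t).fun_mul (hasDerivAt_eval_add_smul p x (-v) t)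
  have hφ' : HasDerivAt φ' (2 * (eval x p * eval x (dirDeriv v (dirDeriv v p)) -
      eval x (dirDeriv v p) ^ 2)) 0 := by
    refine (((hasDerivAt_eval_add_smul (dirDeriv v p) x v 0).fun_mul
      (hasDerivAt_eval_add_smul p x (-v) 0)).fun_add ((hasDerivAt_eval_add_smul p x v 0).fun_mul
      (hasDerivAt_eval_add_smul (dirDeriv (-v) p) x (-v) 0))).congr_deriv ?_
    simp only [zero_smul, add_zero, map_neg, LinearMap.neg_apply, neg_neg]
    ring
  have hmax : IsLocalMax φ 0 := by
    have hnear (w : Fin n → ℝ) : ∀ᶠ t : ℝ in 𝓝 0, 0 ≤ x + t • w := by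
      refine (eventually_all.2 fun i => ?_)
      have hcont : ContinuousAt (fun t : ℝ => x i + t * w i) 0 := by fun_prop
      filter_upwards [hcont.eventually_const_lt (by simpa using hx i)] with t ht using ht.le
    filter_upwards [hnear v, hnear (-v)] with t hv hv'
    simpa [φ, ← sub_eq_add_neg, sq] using
      h.eval_mul_eval_le_sq hv (by simpa [sub_eq_add_neg] using hv')
  have hle := deriv_deriv_nonpos_of_isLocalMax hmax (hφ 0).continuousAt
  rw [show deriv φ = φ' from funext fun t => (hφ t).deriv, hφ'.deriv] at hle
  linarith

theorem IsLogConcave.isHyperbolic_hessian (h : IsLogConcave p) (hx : ∀ i, 0 < x i) :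
    IsHyperbolic (hessian p x) := by
  rcases eq_or_ne p 0 with rfl | hp0
  · convert isHyperbolic_zero
    ext; simp [hessian_apply]
  · refine isHyperbolic_of_nonpos_of_mem_ker (isSymm_hessian p x)
      ((aeval x).toLinearMap ∘ₗ dirDeriv.flip p) fun v hv => ?_
    have hle := h.eval_mul_eval_dirDeriv_dirDeriv_le_sq hx v
    rw [show eval x (dirDeriv v p) = 0 by simpa using hv,
      zero_pow two_ne_zero] at hle
    exact nonpos_of_mul_nonpos_right hle (eval_pos_of_coeff_nonneg h.1 hp0 hx)

end LogConcave

section MixedDeriv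

variable {n k : ℕ} {p : MvPolynomial (Fin n) ℝ} {x : Fin n → ℝ} {ι : Type*} {u : ι → Fin n → ℝ}
  {T : Finset ι}

theorem IsLogConcave.isHyperbolic_hessian_pow_dirDeriv_mixedDeriv (h : IsLogConcave p)
    (hp : p.IsHomogeneous k) (hx : ∀ i, 0 < x i) (hu : ∀ i ∈ T, 0 ≤ u i)
    (hsq : ∀ i ∈ T, dirDeriv (u i) (dirDeriv (u i) p) = 0) (hne : mixedDeriv u T p ≠ 0)
    (hT : #T ≤ k) {B : Finset ι} (hB : B ⊆ T) {j : ℕ} (hj : #B + j + 2 ≤ #T) :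
    IsHyperbolic (hessian ((dirDeriv (∑ i ∈ T, u i) ^ j) (mixedDeriv u B p)) x) := by
  classical
  have hLC {A : Finset ι} (hA : A ⊆ T) : IsLogConcave (mixedDeriv u A p) :=
    isLogConcave_mixedDeriv h (fun i hi => hu i (hA hi)) fun i hi => hsq i (hA hi)
  set v := ∑ i ∈ T, u i with hv
  have hv0 : 0 ≤ v := sum_nonneg hu
  induction j generalizing B with
  | zero => exact (hLC hB).isHyperbolic_hessian hx
  | succ j ih =>
    have hstep : (dirDeriv v ^ (j + 1)) (mixedDeriv u B p) =
        dirDeriv (∑ i ∈ T \ B, u i) ((dirDeriv v ^ j) (mixedDeriv u B p)) := by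
      rw [pow_succ, Module.End.mul_apply, hv, dirDeriv_sum_mixedDeriv hsq hB,
        dirDeriv_pow_dirDeriv_comm]
    have hinsert {A : Finset ι} {i : ι} (hi : i ∉ A) :
        dirDeriv (u i) ((dirDeriv v ^ j) (mixedDeriv u A p)) =
          (dirDeriv v ^ j) (mixedDeriv u (insert i A) p) := by
      rw [dirDeriv_pow_dirDeriv_comm, mixedDeriv_insert hi]
    rw [hstep]
    refine isHyperbolic_hessian_dirDeriv_sum
      (isHomogeneous_pow_dirDeriv (isHomogeneous_mixedDeriv hp B) v j) (by omega)
      (coeff_pow_dirDeriv_nonneg (hLC hB).1 hv0 j) (fun i => (hx i).le)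
      (fun i hi => hu i (mem_sdiff.1 hi).1) (fun i hi l hl hil => ?_) fun i hi => ?_
    · obtain ⟨hiT, hiB⟩ := mem_sdiff.1 hi
      obtain ⟨hlT, hlB⟩ := mem_sdiff.1 hl
      have hi' : i ∉ insert l B := by simp [hil, hiB]
      have hsub : insert i (insert l B) ⊆ T := insert_subset hiT (insert_subset hlT hB)
      rw [hinsert hlB, hinsert hi']
      refine eval_pos_of_coeff_nonneg (coeff_pow_dirDeriv_nonneg (hLC hsub).1 hv0 j)
        (pow_dirDeriv_sum_mixedDeriv_ne_zero hsq hne hsub ?_) hx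
      rw [card_insert_of_notMem hi', card_insert_of_notMem hlB]
      omega
    · obtain ⟨hiT, hiB⟩ := mem_sdiff.1 hi
      rw [hinsert hiB]
      refine ih (insert_subset hiT hB) ?_
      rw [card_insert_of_notMem hiB]
      omega

theorem IsLogConcave.newton_inequality (h : IsLogConcave p)
    (hp : p.IsHomogeneous k) (hx : ∀ i, 0 < x i) (hu : ∀ i ∈ T, 0 ≤ u i)
    (hsq : ∀ i ∈ T, dirDeriv (u i) (dirDeriv (u i) p) = 0) (hne : mixedDeriv u T p ≠ 0)
    (hT : #T ≤ k) {j : ℕ} (hj : j + 2 ≤ #T) :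
    (k - j) * (eval x ((dirDeriv (∑ i ∈ T, u i) ^ j) p) *
        eval x ((dirDeriv (∑ i ∈ T, u i) ^ (j + 2)) p)) ≤
      (k - j - 1) * eval x ((dirDeriv (∑ i ∈ T, u i) ^ (j + 1)) p) ^ 2 := by
  obtain ⟨d, rfl⟩ : ∃ d, k = d + 1 + j := ⟨k - 1 - j, by omega⟩
  have hhyp := h.isHyperbolic_hessian_pow_dirDeriv_mixedDeriv hp hx hu hsq hne hT (empty_subset T)
    (j := j) (by simpa using hj)
  have hne' := pow_dirDeriv_sum_mixedDeriv_ne_zero hsq hne (empty_subset T) (j := j)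
    (by rw [card_empty]; omega)
  rw [mixedDeriv_empty] at hhyp hne'
  have hpos := eval_pos_of_coeff_nonneg (coeff_pow_dirDeriv_nonneg h.1 (sum_nonneg hu) j) hne' hx
  have hhom := isHomogeneous_pow_dirDeriv hp (∑ i ∈ T, u i) j
  rw [Nat.add_sub_cancel] at hhom
  have hnewton := newton_inequality_of_isHyperbolic_hessian hhom (by omega) hpos hhyp (∑ i ∈ T, u i)
  simp only [pow_succ', Module.End.mul_apply]
  push_cast
  convert hnewton using 2 <;> ring

theorem IsLogConcave.pow_mul_eval_mixedDeriv_le (h : IsLogConcave p)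
    (hp : p.IsHomogeneous k) (hx : ∀ i, 0 < x i) (hu : ∀ i ∈ T, 0 ≤ u i)
    (hsq : ∀ i ∈ T, dirDeriv (u i) (dirDeriv (u i) p) = 0) (hne : mixedDeriv u T p ≠ 0)
    (hT : #T ≤ k) :
    (k * eval x p) ^ #T * eval x (mixedDeriv u T p) ≤
      k.choose #T * (∑ i ∈ T, eval x (dirDeriv (u i) p)) ^ #T * eval x p := by
  have hpos : ∀ j ≤ #T, 0 < eval x ((dirDeriv (∑ i ∈ T, u i) ^ j) p) := fun j hj => by
    refine eval_pos_of_coeff_nonneg (coeff_pow_dirDeriv_nonneg h.1 (sum_nonneg hu) j) ?_ hx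
    simpa only [mixedDeriv_empty] using
      pow_dirDeriv_sum_mixedDeriv_ne_zero hsq hne (empty_subset T) (j := j) (by simpa using hj)
  have htop : eval x ((dirDeriv (∑ i ∈ T, u i) ^ #T) p) =
      (#T).factorial * eval x (mixedDeriv u T p) := by
    simpa [mixedDeriv_empty] using congrArg (eval x)
      (pow_dirDeriv_sum_mixedDeriv hsq (empty_subset T) (j := #T) (by simp))
  have hle := pow_mul_le_descFactorial_mul_of_newton_inequalities hT hpos
    fun j hj => h.newton_inequality hp hx hu hsq hne hT hj
  rw [htop, Nat.descFactorial_eq_factorial_mul_choose] at hle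
  simp only [pow_zero, pow_one, Module.End.one_apply, map_sum, LinearMap.sum_apply,
    Nat.cast_mul] at hle
  refine le_of_mul_le_mul_left ?_ (Nat.cast_pos.2 (#T).factorial_pos : (0 : ℝ) < _)
  linarith

theorem IsLogConcave.pow_mul_eval_mixedDeriv_le_mean (h : IsLogConcave p)
    (hp : p.IsHomogeneous k) (hx : ∀ i, 0 < x i) (hu : ∀ i ∈ T, 0 ≤ u i)
    (hsq : ∀ i ∈ T, dirDeriv (u i) (dirDeriv (u i) p) = 0) (hne : mixedDeriv u T p ≠ 0)
    (hT : #T ≤ k) :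
    eval x p ^ #T * eval x (mixedDeriv u T p) ≤
      alpha k #T * ((∑ i ∈ T, eval x (dirDeriv (u i) p)) / #T) ^ #T * eval x p := by
  have hle := h.pow_mul_eval_mixedDeriv_le hp hx hu hsq hne hT
  rcases T.eq_empty_or_nonempty with rfl | hT0
  · simpa [alpha] using hle
  have hl := card_pos.2 hT0
  have hk : 0 < k := hl.trans_le hT
  rw [mul_pow, mul_assoc, ← le_div_iff₀' (by positivity)] at hle
  refine hle.trans_eq ?_
  rw [alpha, div_pow, div_pow]
  field_simp

theorem IsLogConcave.pow_mul_eval_mixedDeriv_le_prod (h : IsLogConcave p)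
    (hp : p.IsHomogeneous k) (hx : ∀ i, 0 < x i) (hu : ∀ i ∈ T, 0 ≤ u i)
    (hsq : ∀ i ∈ T, dirDeriv (u i) (dirDeriv (u i) p) = 0) (hT : #T ≤ k) :
    eval x p ^ #T * eval x (mixedDeriv u T p) ≤
      alpha k #T * (∏ i ∈ T, eval x (dirDeriv (u i) p)) * eval x p := by
  classical
  rcases eq_or_ne (mixedDeriv u T p) 0 with h0 | hne
  · rw [h0, map_zero, mul_zero]
    have hprod : 0 ≤ ∏ i ∈ T, eval x (dirDeriv (u i) p) := prod_nonneg fun i hi =>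
      eval_nonneg_of_coeff_nonneg (coeff_dirDeriv_nonneg h.1 (hu i hi)) fun j => (hx j).le
    have hpx := eval_nonneg_of_coeff_nonneg h.1 fun i => (hx i).le
    unfold alpha
    positivity
  have hpos : ∀ i ∈ T, 0 < eval x (dirDeriv (u i) p) := fun i hi =>
    eval_pos_of_coeff_nonneg (coeff_dirDeriv_nonneg h.1 (hu i hi))
      (fun h0 => hne (by rw [mixedDeriv_eq_mixedDeriv_erase hi, h0, map_zero])) hx
  -- The bound by the arithmetic mean is sharpest when the directions are scaled so that the
  -- derivatives at `x` agree.
  set c : ι → ℝ := fun i => (eval x (dirDeriv (u i) p))⁻¹ with hc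
  have hc0 : ∀ i ∈ T, 0 < c i := fun i hi => inv_pos.2 (hpos i hi)
  have hprod : 0 < ∏ i ∈ T, c i := prod_pos hc0
  have hle := h.pow_mul_eval_mixedDeriv_le_mean (u := fun i => c i • u i) hp hx
    (fun i hi => smul_nonneg (hc0 i hi).le (hu i hi)) (fun i hi => by simp [hsq i hi])
    (by rw [mixedDeriv_smul]; exact smul_ne_zero hprod.ne' hne) hT
  have hsum : ∑ i ∈ T, eval x (dirDeriv (c i • u i) p) = #T := by
    rw [sum_congr rfl (g := fun _ => (1 : ℝ)) fun i hi => by simp [smul_eval, c, (hpos i hi).ne']]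
    simp
  have hmean : ((#T : ℝ) / #T) ^ #T = 1 := by
    rcases eq_or_ne #T 0 with h0 | h0 <;> simp [h0]
  rw [hsum, hmean, mul_one, mixedDeriv_smul, smul_eval, hc, prod_inv_distrib, mul_left_comm,
    inv_mul_le_iff₀ (prod_pos hpos)] at hle
  linarith

end MixedDeriv

section GenPoly

section Monomial

variable {R σ : Type*} [CommRing R] [DecidableEq σ]

theorem pderiv_prod_X (i : σ) (S : Finset σ) :
    pderiv i (∏ j ∈ S, X j : MvPolynomial σ R) = if i ∈ S then ∏ j ∈ S.erase i, X j else 0 := by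
  have hzero (A : Finset σ) (hi : i ∉ A) : pderiv i (∏ j ∈ A, X j : MvPolynomial σ R) = 0 := by
    induction A using Finset.induction_on with
    | empty => simp
    | insert j A hj ih =>
      rw [mem_insert, not_or] at hi
      rw [prod_insert hj, pderiv_mul, pderiv_X_of_ne (Ne.symm hi.1), ih hi.2]
      simp
  split_ifs with hi
  · rw [← mul_prod_erase S _ hi, pderiv_mul, hzero _ (notMem_erase i S)]
    simp
  · exact hzero S hi

theorem mixedDeriv_single_prod_X [Fintype σ] (T S : Finset σ) :
    mixedDeriv (fun i => Pi.single i 1) T (∏ j ∈ S, X j : MvPolynomial σ R) =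
      if T ⊆ S then ∏ j ∈ S \ T, X j else 0 := by
  induction T using Finset.induction_on with
  | empty => simp [mixedDeriv_empty]
  | insert i T hi ih =>
    rw [mixedDeriv_insert hi, ih, dirDeriv_single, one_smul]
    by_cases hT : T ⊆ S <;> by_cases hiS : i ∈ S <;>
      simp [hT, hiS, hi, pderiv_prod_X, insert_subset_iff, sdiff_insert]

end Monomial

variable {n k : ℕ} (μ : KSubset n k → ℝ)

theorem genPoly_eq_sum_smul : genPoly μ = ∑ S, μ S • ∏ i ∈ S.1, X i := by
  simp only [genPoly, smul_eq_C_mul]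

theorem isHomogeneous_genPoly : (genPoly μ).IsHomogeneous k :=
  IsHomogeneous.sum _ _ _ fun S _ => by
    simpa [S.2] using (isHomogeneous_C _ (μ S)).mul
      (IsHomogeneous.prod S.1 _ _ fun i _ => isHomogeneous_X ℝ i)

theorem dirDeriv_single_dirDeriv_single_genPoly (i : Fin n) :
    dirDeriv (Pi.single i 1) (dirDeriv (Pi.single i 1) (genPoly μ)) = 0 := by
  simp only [genPoly_eq_sum_smul, map_sum, map_smul, dirDeriv_single, one_smul]
  exact sum_eq_zero fun S _ => by
    by_cases hi : i ∈ S.1 <;> simp [pderiv_prod_X, hi]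

theorem eval_one_mixedDeriv_genPoly (T : Finset (Fin n)) :
    eval 1 (mixedDeriv (fun i => Pi.single i 1) T (genPoly μ)) = prob μ (fun S => T ⊆ S) := by
  simp only [genPoly_eq_sum_smul, map_sum, map_smul, mixedDeriv_single_prod_X, prob, sum_filter,
    smul_eval]
  refine sum_congr rfl fun S _ => ?_
  split_ifs <;> simp

theorem eval_one_dirDeriv_genPoly (i : Fin n) :
    eval 1 (dirDeriv (Pi.single i 1) (genPoly μ)) = prob μ (fun S => i ∈ S) := by
  simpa [mixedDeriv_singleton] using eval_one_mixedDeriv_genPoly μ {i}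

variable {μ}

theorem eval_one_genPoly (hμ : μ ∈ stdSimplex ℝ (KSubset n k)) : eval 1 (genPoly μ) = 1 := by
  rw [← hμ.2]
  simpa [mixedDeriv_empty, prob] using eval_one_mixedDeriv_genPoly μ ∅

theorem prob_subset_le (hμ : μ ∈ stdSimplex ℝ (KSubset n k)) (h : IsLogConcave (genPoly μ))
    (T : Finset (Fin n)) (hT : #T ≤ k) :
    prob μ (fun S => T ⊆ S) ≤ alpha k #T * ∏ i ∈ T, prob μ (fun S => i ∈ S) := by
  simpa only [eval_one_genPoly hμ, eval_one_mixedDeriv_genPoly, eval_one_dirDeriv_genPoly,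
    one_pow, one_mul, mul_one] using
    h.pow_mul_eval_mixedDeriv_le_prod (u := fun i => Pi.single i 1) (x := 1) (T := T)
      (isHomogeneous_genPoly μ) (fun _ => one_pos)
      (fun _ _ => Pi.single_nonneg.2 zero_le_one)
      (fun i _ => dirDeriv_single_dirDeriv_single_genPoly μ i) hT

end GenPoly

theorem alpha_le_pow_div_factorial (k l : ℕ) : alpha k l ≤ (l : ℝ) ^ l / (l.factorial : ℝ) := by
  rcases eq_or_ne k 0 with rfl | hk
  · cases l with
    | zero => simp [alpha]
    | succ l =>
      rw [alpha, Nat.choose_zero_succ, Nat.cast_zero, zero_mul]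
      positivity
  · calc alpha k l ≤ (k : ℝ) ^ l / l.factorial * ((l : ℝ) / k) ^ l :=
          mul_le_mul_of_nonneg_right (Nat.choose_le_pow_div l k) (by positivity)
      _ = (l : ℝ) ^ l / l.factorial := by rw [div_pow]; field_simp

end SetDist

theorem mainTheorem7 :
    (∀ (n k l : ℕ) (μ : SetDist.KSubset n k → ℝ),
      μ ∈ stdSimplex ℝ (SetDist.KSubset n k) →
      SetDist.IsLogConcave (SetDist.genPoly μ) →
      ∀ T : Finset (Fin n), T.card = l → l ≤ k →
        SetDist.prob μ (fun S => T ⊆ S) ≤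
          SetDist.alpha k l * ∏ i ∈ T, SetDist.prob μ (fun S => i ∈ S)) ∧
    (∀ k l : ℕ, l ≤ k → SetDist.alpha k l ≤ (l : ℝ) ^ l / (l.factorial : ℝ)) ∧
    (∀ k : ℕ, 2 ≤ k → SetDist.alpha k 2 ≤ 2) ∧
    (∀ k l : ℕ, l ≤ k → SetDist.alpha k l ≤ Real.exp (l : ℝ)) := by
  refine ⟨?_, fun k l _ => SetDist.alpha_le_pow_div_factorial k l, fun k _ => ?_, fun k l _ => ?_⟩
  · rintro n k l μ hμ h T rfl hT
    exact SetDist.prob_subset_le hμ h T hT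
  · exact (SetDist.alpha_le_pow_div_factorial k 2).trans_eq (by norm_num [Nat.factorial])
  · exact (SetDist.alpha_le_pow_div_factorial k l).trans
      (Real.pow_div_factorial_le_exp _ (Nat.cast_nonneg l) l)
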